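/- Let $\mathbb{K}$ be $\mathbb{R}$ or $\mathbb{C}$, let $\Omega \subset \mathbb{R}^d$ be a bounded open set (with Lebesgue measure), let $p \in [1,\infty)$, and write $L_p(\Omega)$ and $C(\overline\Omega)$ for the corresponding spaces of $\mathbb{K}$-valued functions, ordered almost everywhere and pointwise, respectively. Conventions. Let $E$ be $L_p(\Omega)$ or $C(\overline\Omega)$. A *semigroup* on $E$ is a map $S\colon(0,\infty)\to\mathcal{L}(E)$ with $S_{t+s}=S_tS_s$ for all $s,t>0$. It is a *$C_0$-semigroup* if $\lim_{t\downarrow 0}S_tu=u$ for all $u\in E$, and *positive* if $S_tu\ge 0$ for all $t>0$ and $u\ge 0$. An *ideal* of $E$ is a subspace $J$ such that $|u|\in J$ for all $u\in J$, and such that $v\in J$ whenever $u\in J$, $v\in E$ and $0\le v\le u$. The semigroup $S$ is *irreducible* if the only closed ideals $J$ of $E$ with $S_tJ\subset J$ for all $t>0$ are $J=E$ and $J=\{0\}$. A $C_0$-semigroup on $L_p(\Omega)$ is *holomorphic* if, for some $\theta\in(0,\pi/2]$, it (or its complexification, if $\mathbb{K}=\mathbb{R}$) has a holomorphic extension, with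 values in the bounded operators, to the sector $\Sigma_\theta=\{z\in\mathbb{C}\setminus\{0\}:|\arg z|<\theta\}$ that is bounded on $\Sigma_{\theta'}\cap\{|z|\le 1\}$ for all $\theta'\in(0,\theta)$. For $u \ge 0$ in $C(\overline\Omega)$ one writes $u\gg 0$ if the principal ideal $\{v:|v|\le n\,u\text{ for some }n\in\mathbb{N}\}$ is dense in $C(\overline\Omega)$; an operator $R\colon L_p(\Omega)\to C(\overline\Omega)$ is *positivity improving* if $Ru\gg 0$ for all $u\ge 0$ with $u\ne 0$. An element $u\in L_p(\Omega)$ belongs to $C(\overline\Omega)$ if there is a (necessarily unique) $\tilde u\in C(\overline\Omega)$ with $\tilde u=u$ almost everywhere on $\Omega$, and then $u$ and $\tilde u$ are identified. Let $S$ be a positive irreducible holomorphic $C_0$-semigroup on $L_p(\Omega)$. Suppose that (I) $S_tL_p(\Omega)\subset C(\overline\Omega)$ for all $t>0$, and (II) for all $x\in\overline\Omega$ there are $t>0$ and $w\in L_p(\Omega)$ such that $(S_tw)(x)\neq 0$. Then the following hold. (a) For all $t>0$ the map $S_t\colon L_p(\Omega)\to C(\overline\Omega)$ is a bounded linear operator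 and it is positivity improving; in particular $(S_tu)(x)>0$ for all $x\in\overline\Omega$, $t>0$ and $u\in L_p(\Omega)$ with $u\ge 0$ and $u\ne 0$. (b) For all $t>0$ define $T_t=S_t|_{C(\overline\Omega)}\colon C(\overline\Omega)\to C(\overline\Omega)$. Then $T=(T_t)_{t>0}$ is a semigroup of bounded operators on $C(\overline\Omega)$, and it is irreducible. -/

import Mathlib

open MeasureTheory Filter Topology
open scoped ENNReal ComplexOrder

noncomputable section

namespace LpSemigroup

/-- The modulus map `u ↦ |u|` of a (real or complex) space of functions. -/
class Modulus (E : Type*) where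
  modulus : E → E

/-- On `C(X)`: `|f|(x) = |f(x)|`. -/
instance instModulusContinuousMap {𝕜 : Type*} [RCLike 𝕜] {X : Type*} [TopologicalSpace X] :
    Modulus C(X, 𝕜) where
  modulus f := ⟨fun x => ((‖f x‖ : ℝ) : 𝕜), by fun_prop⟩

/-- The map `z ↦ |z|`, seen as a map from the scalar field into itself, is `1`-Lipschitz. -/
theorem lipschitzWith_ofReal_norm (𝕜 : Type*) [RCLike 𝕜] :
    LipschitzWith 1 (fun z : 𝕜 => ((‖z‖ : ℝ) : 𝕜)) := by
  refine LipschitzWith.of_dist_le_mul fun x y => ?_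
  rw [dist_eq_norm, dist_eq_norm, ← RCLike.ofReal_sub, RCLike.norm_ofReal, NNReal.coe_one,
    one_mul]
  exact abs_norm_sub_norm_le x y

/-- On `L_p`: `|u|(x) = |u(x)|` almost everywhere. -/
instance instModulusLp {𝕜 : Type*} [RCLike 𝕜] {X : Type*} [MeasurableSpace X]
    {μ : Measure X} {p : ℝ≥0∞} : Modulus (Lp 𝕜 p μ) where
  modulus u := (lipschitzWith_ofReal_norm 𝕜).compLp (by simp) u

section Lattice

variable (𝕜 : Type*) [RCLike 𝕜] {E F : Type*} [AddCommGroup E] [Module 𝕜 E]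
  [PartialOrder E] [Modulus E] [TopologicalSpace E]
  [AddCommGroup F] [Module 𝕜 F] [PartialOrder F] [Modulus F] [TopologicalSpace F]

/-- A lattice ideal: a subspace `J` such that `|u| ∈ J` for all `u ∈ J`, and `v ∈ J` whenever
`0 ≤ v ≤ u` with `u ∈ J`. -/
structure IsIdeal (J : Submodule 𝕜 E) : Prop where
  modulus_mem : ∀ u ∈ J, Modulus.modulus u ∈ J
  mem_of_le : ∀ u ∈ J, ∀ v : E, 0 ≤ v → v ≤ u → v ∈ J

/-- The principal ideal `E_u = {v : |v| ≤ n u for some n ∈ ℕ}` generated by `u ≥ 0`. -/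
def principalIdeal (u : E) : Set E :=
  {v | ∃ n : ℕ, Modulus.modulus v ≤ n • u}

/-- `u ≫ 0`: `u ≥ 0` is a quasi-interior point, that is, `E_u` is dense. -/
def IsQuasiInterior (u : E) : Prop :=
  0 ≤ u ∧ closure (principalIdeal u) = Set.univ

variable {𝕜}

/-- `R u ≫ 0` whenever `u ≥ 0` and `u ≠ 0`. -/
def IsPositivityImproving (R : E →L[𝕜] F) : Prop :=
  ∀ u : E, 0 ≤ u → u ≠ 0 → IsQuasiInterior (R u)

/-- A semigroup `(S_t)_{t > 0}` of bounded operators; values of `S` at `t ≤ 0` play no role. -/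
def IsSemigroup (S : ℝ → E →L[𝕜] E) : Prop :=
  ∀ s t : ℝ, 0 < s → 0 < t → S (s + t) = (S s).comp (S t)

/-- A `C₀`-semigroup: in addition, `S_t u → u` as `t ↓ 0`. -/
structure IsC0Semigroup (S : ℝ → E →L[𝕜] E) : Prop where
  isSemigroup : IsSemigroup S
  tendsto_zero : ∀ u : E, Tendsto (fun t => S t u) (𝓝[>] 0) (𝓝 u)

/-- `S_t ≥ 0` for all `t > 0`. -/
def IsPositiveSemigroup (S : ℝ → E →L[𝕜] E) : Prop :=
  ∀ t : ℝ, 0 < t → ∀ u : E, 0 ≤ u → 0 ≤ S t u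

/-- Irreducibility: the only closed ideals invariant under all `S_t`, `t > 0`, are `E` and `{0}`. -/
def IsIrreducible (S : ℝ → E →L[𝕜] E) : Prop :=
  ∀ J : Submodule 𝕜 E, IsIdeal 𝕜 J → IsClosed (J : Set E) →
    (∀ t : ℝ, 0 < t → ∀ u ∈ J, S t u ∈ J) → J = ⊤ ∨ J = ⊥

end Lattice

/-- The open sector `{z ≠ 0 : |arg z| < θ}`. -/
def sector (θ : ℝ) : Set ℂ :=
  {z | z ≠ 0 ∧ |z.arg| < θ}

/-- `S` is a holomorphic semigroup on `L_p`: for some `θ ∈ (0, π/2]` it has a holomorphic extension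
`H` to the sector of half-angle `θ`, with values in the bounded operators on the complex space
`L_p`, which is bounded on `{z : |arg z| < θ', |z| ≤ 1}` for every `θ' ∈ (0, θ)`.
If `𝕜 = ℂ`, then `RCLike.map 𝕜 ℂ` is the identity and `H` extends `S` itself; if `𝕜 = ℝ`, then it is
the inclusion of `ℝ` in `ℂ` and `H` extends the complexification of `S`. -/
def IsHolomorphicSemigroup {𝕜 : Type*} [RCLike 𝕜] {X : Type*} [MeasurableSpace X]
    {μ : Measure X} {p : ℝ≥0∞} [Fact (1 ≤ p)] (S : ℝ → Lp 𝕜 p μ →L[𝕜] Lp 𝕜 p μ) : Prop :=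
  ∃ θ : ℝ, 0 < θ ∧ θ ≤ Real.pi / 2 ∧ ∃ H : ℂ → Lp ℂ p μ →L[ℂ] Lp ℂ p μ,
    DifferentiableOn ℂ H (sector θ) ∧
    (∀ θ' : ℝ, 0 < θ' → θ' < θ → ∃ C : ℝ, ∀ z ∈ sector θ', ‖z‖ ≤ 1 → ‖H z‖ ≤ C) ∧
    ∀ t : ℝ, 0 < t → ∀ u : Lp 𝕜 p μ,
      H (t : ℂ) ((RCLike.map 𝕜 ℂ).compLp u) = (RCLike.map 𝕜 ℂ).compLp (S t u)

/-- `f ∈ C(closure Ω)` is a continuous version of `u ∈ L_p(Ω)`: `f = u` almost everywhere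
on `Ω`. For bounded `Ω` the space `C(closure Ω, 𝕜)` carries the topology of uniform convergence
(the compact-open topology on functions on a compact space). -/
def IsContinuousVersion {𝕜 : Type*} [RCLike 𝕜] {d : ℕ} {Ω : Set (EuclideanSpace ℝ (Fin d))}
    {p : ℝ≥0∞} (f : C(closure Ω, 𝕜)) (u : Lp 𝕜 p (volume.restrict Ω)) : Prop :=
  ∀ᵐ x ∂(volume.restrict Ω), ∀ hx : x ∈ closure Ω, f ⟨x, hx⟩ = u x

end LpSemigroup

end

/-! Fix `x` in the closure of `Ω` and a small `ε`. Evaluating the continuous version of `S_ε v` at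
`x` gives a positive bounded functional `ψ` on `L_p`; boundedness comes from the closed graph
theorem. Pointwise positivity, boundary points included, thus becomes a statement about functionals
(`functional_eq_zero`): if `f ≥ 0`, `f ≠ 0` and `ψ (S_{t₀} f) = 0`, then `ψ = 0`, which (II)
excludes.

That statement has two halves. Analyticity (`apply_orbit_eq_zero`): choose `τ_m → 0` with `∑ ‖f -
S_{τ_m} f‖ < ∞`. Cutting off the tails of `∑ (f - S_{τ_m} f)⁺` gives `g_n → f` with `0 ≤ g_n ≤
S_{τ_m} f` for all `m ≥ n`. Then `0 ≤ ψ (S_{t₀ - τ_m} g_n) ≤ ψ (S_{t₀} f) = 0`, so the zeros of `t ↦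
ψ (S_t g_n)` accumulate at `t₀` and the function vanishes; let `n → ∞`. Irreducibility: the `u` with
`ψ (S_t |u|) = 0` for all `t > 0` form a closed invariant ideal containing `f`, hence all of `L_p`;
let `t ↓ 0`.

For (b), an invariant ideal containing some `f ≠ 0` contains `T_1 |f|`, which is bounded below by a
positive constant on the compact closure, so the ideal is everything. -/

namespace LpSemigroup

/-! ### Order and modulus on `L_p`. -/

section LpOrder

variable {𝕜 : Type*} [RCLike 𝕜] {X : Type*} [MeasurableSpace X] {μ : Measure X} {p : ℝ≥0∞}

theorem lipschitzWith_ofReal_max_re (𝕜 : Type*) [RCLike 𝕜] :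
    LipschitzWith 1 (fun z : 𝕜 => ((max (RCLike.re z) 0 : ℝ) : 𝕜)) := by
  refine LipschitzWith.of_dist_le_mul fun x y => ?_
  rw [dist_eq_norm, dist_eq_norm, ← RCLike.ofReal_sub, RCLike.norm_ofReal, NNReal.coe_one,
    one_mul]
  refine (abs_max_sub_max_le_abs _ _ _).trans ?_
  rw [← map_sub]
  exact RCLike.abs_re_le_norm _

/-- The positive part of the real part of an element of `L_p`. -/
def posRe (u : Lp 𝕜 p μ) : Lp 𝕜 p μ :=
  (lipschitzWith_ofReal_max_re 𝕜).compLp (by simp) u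

theorem coeFn_posRe (u : Lp 𝕜 p μ) :
    ∀ᵐ x ∂μ, posRe u x = ((max (RCLike.re (u x)) 0 : ℝ) : 𝕜) :=
  (lipschitzWith_ofReal_max_re 𝕜).coeFn_compLp (by simp) u

theorem coeFn_modulus (u : Lp 𝕜 p μ) :
    ∀ᵐ x ∂μ, (Modulus.modulus u : Lp 𝕜 p μ) x = ((‖u x‖ : ℝ) : 𝕜) :=
  (lipschitzWith_ofReal_norm 𝕜).coeFn_compLp (by simp) u

theorem nonneg_iff_ae {u : Lp 𝕜 p μ} : 0 ≤ u ↔ ∀ᵐ x ∂μ, 0 ≤ u x :=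
  (Lp.coeFn_nonneg u).symm

theorem le_iff_ae {u v : Lp 𝕜 p μ} : u ≤ v ↔ ∀ᵐ x ∂μ, u x ≤ v x :=
  (Lp.coeFn_le u v).symm

theorem posRe_nonneg (u : Lp 𝕜 p μ) : 0 ≤ posRe u := by
  rw [nonneg_iff_ae]
  filter_upwards [coeFn_posRe u] with x hx
  rw [hx, RCLike.ofReal_nonneg]
  exact le_max_right _ _

theorem modulus_nonneg (u : Lp 𝕜 p μ) : 0 ≤ (Modulus.modulus u : Lp 𝕜 p μ) := by
  rw [nonneg_iff_ae]
  filter_upwards [coeFn_modulus u] with x hx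
  rw [hx, RCLike.ofReal_nonneg]
  exact norm_nonneg _

theorem modulus_of_nonneg {u : Lp 𝕜 p μ} (hu : 0 ≤ u) : Modulus.modulus u = u := by
  apply Lp.ext
  filter_upwards [coeFn_modulus u, nonneg_iff_ae.1 hu] with x hx hx'
  rw [hx, RCLike.norm_of_nonneg' hx']

theorem posRe_of_nonneg {u : Lp 𝕜 p μ} (hu : 0 ≤ u) : posRe u = u := by
  apply Lp.ext
  filter_upwards [coeFn_posRe u, nonneg_iff_ae.1 hu] with x hx hx'
  obtain ⟨h1, h2⟩ := RCLike.nonneg_iff.1 hx'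
  rw [hx, max_eq_left h1]
  apply RCLike.ext <;> simp [h2]

theorem modulus_add_le (u v : Lp 𝕜 p μ) :
    (Modulus.modulus (u + v) : Lp 𝕜 p μ) ≤ Modulus.modulus u + Modulus.modulus v := by
  rw [le_iff_ae]
  filter_upwards [coeFn_modulus (u + v), coeFn_modulus u, coeFn_modulus v, Lp.coeFn_add u v,
    Lp.coeFn_add (Modulus.modulus u) (Modulus.modulus v)] with x h1 h2 h3 h4 h5
  rw [h1, h5, h4, Pi.add_apply, Pi.add_apply, h2, h3, ← RCLike.ofReal_add, RCLike.ofReal_le_ofReal]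
  exact norm_add_le _ _

theorem modulus_smul (c : 𝕜) (u : Lp 𝕜 p μ) :
    (Modulus.modulus (c • u) : Lp 𝕜 p μ) = ((‖c‖ : ℝ) : 𝕜) • Modulus.modulus u := by
  apply Lp.ext
  filter_upwards [coeFn_modulus (c • u), coeFn_modulus u, Lp.coeFn_smul c u,
    Lp.coeFn_smul ((‖c‖ : ℝ) : 𝕜) (Modulus.modulus u)] with x h1 h2 h3 h4
  rw [h1, h4, h3, Pi.smul_apply, Pi.smul_apply, h2, smul_eq_mul, smul_eq_mul, norm_mul,
    RCLike.ofReal_mul]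

theorem posRe_smul_le_modulus {c : 𝕜} (hc : ‖c‖ ≤ 1) (u : Lp 𝕜 p μ) :
    posRe (c • u) ≤ Modulus.modulus u := by
  rw [le_iff_ae]
  filter_upwards [coeFn_posRe (c • u), coeFn_modulus u, Lp.coeFn_smul c u] with x h1 h2 h3
  rw [h1, h2, h3, Pi.smul_apply, smul_eq_mul, RCLike.ofReal_le_ofReal]
  refine max_le ((RCLike.re_le_norm _).trans ?_) (norm_nonneg _)
  rw [norm_mul]
  exact mul_le_of_le_one_left (norm_nonneg _) hc

/-- Only an inequality, since `RCLike.I = 0` when `𝕜 = ℝ`. -/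
theorem norm_I_le_one (𝕜 : Type*) [RCLike 𝕜] : ‖(RCLike.I : 𝕜)‖ ≤ 1 := by
  rcases RCLike.I_mul_I_ax (K := 𝕜) with h | h
  · simp [h]
  · have := congrArg norm h
    rw [norm_mul, norm_neg, norm_one] at this
    nlinarith [norm_nonneg (RCLike.I : 𝕜)]

/-- All four pieces have the form `posRe (c • u)` with `‖c‖ ≤ 1`, so `posRe_smul_le_modulus` places
each of them in `[0, |u|]`. -/
theorem eq_posRe_sub_posRe (u : Lp 𝕜 p μ) :
    u = (posRe ((1 : 𝕜) • u) - posRe ((-1 : 𝕜) • u)) + (RCLike.I : 𝕜) •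
      (posRe ((-RCLike.I : 𝕜) • u) - posRe ((RCLike.I : 𝕜) • u)) := by
  have key : ∀ r : ℝ, max r 0 - max (-r) 0 = r := fun r => by
    rcases le_total 0 r with h | h <;> simp [h]
  apply Lp.ext
  filter_upwards [Lp.coeFn_add (posRe ((1 : 𝕜) • u) - posRe ((-1 : 𝕜) • u)) ((RCLike.I : 𝕜) •
      (posRe ((-RCLike.I : 𝕜) • u) - posRe ((RCLike.I : 𝕜) • u))),
    Lp.coeFn_sub (posRe ((1 : 𝕜) • u)) (posRe ((-1 : 𝕜) • u)),
    Lp.coeFn_smul (RCLike.I : 𝕜) (posRe ((-RCLike.I : 𝕜) • u) - posRe ((RCLike.I : 𝕜) • u)),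
    Lp.coeFn_sub (posRe ((-RCLike.I : 𝕜) • u)) (posRe ((RCLike.I : 𝕜) • u)),
    coeFn_posRe ((1 : 𝕜) • u), coeFn_posRe ((-1 : 𝕜) • u), coeFn_posRe ((-RCLike.I : 𝕜) • u),
    coeFn_posRe ((RCLike.I : 𝕜) • u), Lp.coeFn_smul (1 : 𝕜) u, Lp.coeFn_smul (-1 : 𝕜) u,
    Lp.coeFn_smul (-RCLike.I : 𝕜) u, Lp.coeFn_smul (RCLike.I : 𝕜) u]
    with x h1 h2 h3 h4 h5 h6 h7 h8 h9 h10 h11 h12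
  rw [h1, Pi.add_apply, h2, h3, Pi.sub_apply, Pi.smul_apply, h4, Pi.sub_apply, h5, h6, h7, h8, h9,
    h10, h11, h12]
  simp only [Pi.smul_apply, smul_eq_mul, one_mul, neg_mul, map_neg, RCLike.I_mul_re, neg_neg]
  rw [← RCLike.ofReal_sub, ← RCLike.ofReal_sub, key, key, mul_comm, RCLike.re_add_im]

/-- A subspace contains `u` as soon as it contains the order interval `[0, |u|]`. -/
theorem mem_of_forall_le_modulus {K : Submodule 𝕜 (Lp 𝕜 p μ)} {u : Lp 𝕜 p μ}
    (h : ∀ v : Lp 𝕜 p μ, 0 ≤ v → v ≤ Modulus.modulus u → v ∈ K) : u ∈ K := by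
  have h' : ∀ c : 𝕜, ‖c‖ ≤ 1 → posRe (c • u) ∈ K := fun c hc =>
    h _ (posRe_nonneg _) (posRe_smul_le_modulus hc u)
  have hI := norm_I_le_one 𝕜
  rw [eq_posRe_sub_posRe u]
  exact K.add_mem (K.sub_mem (h' _ (by simp)) (h' _ (by simp)))
    (K.smul_mem _ (K.sub_mem (h' _ (by rwa [norm_neg])) (h' _ hI)))

theorem continuous_modulus [Fact (1 ≤ p)] :
    Continuous (Modulus.modulus : Lp 𝕜 p μ → Lp 𝕜 p μ) :=
  (lipschitzWith_ofReal_norm 𝕜).continuous_compLp (by simp)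

theorem continuous_posRe [Fact (1 ≤ p)] : Continuous (posRe : Lp 𝕜 p μ → Lp 𝕜 p μ) :=
  (lipschitzWith_ofReal_max_re 𝕜).continuous_compLp (by simp)

theorem norm_posRe_le (u : Lp 𝕜 p μ) : ‖posRe u‖ ≤ ‖u‖ := by
  have h := (lipschitzWith_ofReal_max_re 𝕜).norm_compLp_le (by simp) u
  rwa [NNReal.coe_one, one_mul] at h

/-- From `u - v ≤ s` follows `u - s ≤ v`. With `u = f`, `v = S_τ f` and a tail sum for `s`, this
puts one cut-off below many orbit points at once. -/
theorem posRe_sub_le {u v s : Lp 𝕜 p μ} (hu : 0 ≤ u) (hv : 0 ≤ v) (hs : posRe (u - v) ≤ s) :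
    posRe (u - s) ≤ v := by
  rw [le_iff_ae] at hs ⊢
  filter_upwards [hs, coeFn_posRe (u - v), coeFn_posRe (u - s), Lp.coeFn_sub u v,
    Lp.coeFn_sub u s, nonneg_iff_ae.1 hu, nonneg_iff_ae.1 hv] with x h1 h2 h3 h4 h5 h6 h7
  rw [h2, h4, Pi.sub_apply] at h1
  rw [h3, h5, Pi.sub_apply]
  obtain ⟨h8, h9⟩ := RCLike.nonneg_iff.1 h7
  have h10 := RCLike.re_le_re h1
  rw [RCLike.ofReal_re, map_sub] at h10
  have h11 := (le_max_left _ _).trans h10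
  rw [RCLike.le_iff_re_im]
  refine ⟨?_, by simp [h9]⟩
  rw [RCLike.ofReal_re, map_sub]
  exact max_le (by linarith) h8

end LpOrder

/-! ### Holomorphic semigroups: the identity theorem and strict positivity. -/

section Holomorphic

variable {𝕜 : Type*} [RCLike 𝕜] {X : Type*} [MeasurableSpace X] {μ : Measure X} {p : ℝ≥0∞}
  [Fact (1 ≤ p)]

theorem map_map_complex (z : 𝕜) : RCLike.map ℂ 𝕜 (RCLike.map 𝕜 ℂ z) = z := by
  simp [RCLike.map_apply, RCLike.re_add_im]

theorem sector_mem_nhds {θ : ℝ} (hθ : 0 < θ) {t : ℝ} (ht : 0 < t) : sector θ ∈ 𝓝 (t : ℂ) := by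
  have h1 : ∀ᶠ z : ℂ in 𝓝 (t : ℂ), z ≠ 0 :=
    isOpen_ne.mem_nhds (Complex.ofReal_ne_zero.2 ht.ne')
  have h2 : ContinuousAt Complex.arg (t : ℂ) := Complex.continuousAt_arg (by simp [ht])
  have h3 : ∀ᶠ z : ℂ in 𝓝 (t : ℂ), |z.arg| < θ :=
    h2.abs.eventually_lt_const (by simpa [Complex.arg_ofReal_of_nonneg ht.le] using hθ)
  filter_upwards [h1, h3] with z hz hz' using ⟨hz, hz'⟩

/-- The orbits of a holomorphic semigroup are real analytic on `(0, ∞)`. -/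
theorem IsHolomorphicSemigroup.analyticOnNhd_orbit {S : ℝ → Lp 𝕜 p μ →L[𝕜] Lp 𝕜 p μ}
    (hS : IsHolomorphicSemigroup S) (u : Lp 𝕜 p μ) :
    AnalyticOnNhd ℝ (fun t => S t u) (Set.Ioi 0) := by
  obtain ⟨θ, hθ, -, H, hH, -, hHS⟩ := hS
  intro t ht
  have h1 : AnalyticAt ℂ H (t : ℂ) := hH.analyticAt (sector_mem_nhds hθ ht)
  let ev : (Lp ℂ p μ →L[ℂ] Lp ℂ p μ) →L[ℂ] Lp ℂ p μ :=
    ContinuousLinearMap.apply ℂ (Lp ℂ p μ) ((RCLike.map 𝕜 ℂ).compLp u)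
  have h2 : AnalyticAt ℂ (fun z => H z ((RCLike.map 𝕜 ℂ).compLp u)) (t : ℂ) :=
    (ev.analyticAt _).comp h1
  have h3 : AnalyticAt ℝ (fun s : ℝ => H (s : ℂ) ((RCLike.map 𝕜 ℂ).compLp u)) t :=
    AnalyticAt.comp (f := fun s : ℝ => (s : ℂ)) (h2.restrictScalars (𝕜 := ℝ))
      (Complex.ofRealCLM.analyticAt t)
  -- The map back to `𝕜` (the real part if `𝕜 = ℝ`) is only real linear, hence the earlier
  -- restriction of scalars.
  have h4 : AnalyticAt ℝ (fun s : ℝ => (RCLike.map ℂ 𝕜).compLpL p μ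
      (H (s : ℂ) ((RCLike.map 𝕜 ℂ).compLp u))) t :=
    (((RCLike.map ℂ 𝕜).compLpL p μ).analyticAt _).comp h3
  refine h4.congr ?_
  filter_upwards [lt_mem_nhds ht] with s hs
  rw [hHS s hs u]
  apply Lp.ext
  filter_upwards [ContinuousLinearMap.coeFn_compLpL (p := p) (RCLike.map ℂ 𝕜)
      ((RCLike.map 𝕜 ℂ).compLp (S s u)),
    ContinuousLinearMap.coeFn_compLp (RCLike.map 𝕜 ℂ) (S s u)] with x h1 h2
  rw [h1, h2, map_map_complex]

variable {S : ℝ → Lp 𝕜 p μ →L[𝕜] Lp 𝕜 p μ} {ψ : Lp 𝕜 p μ →L[𝕜] 𝕜}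

theorem exists_seq_norm_apply_sub_le (hS : IsC0Semigroup S) (f : Lp 𝕜 p μ) :
    ∃ τ : ℕ → ℝ, (∀ m, 0 < τ m) ∧ Tendsto τ atTop (𝓝 0) ∧
      ∀ m, ‖f - S (τ m) f‖ ≤ (1 / 2) ^ m := by
  have h : ∀ m : ℕ, ∃ t : ℝ, 0 < t ∧ t < 1 / ((m : ℝ) + 1) ∧ ‖f - S t f‖ ≤ (1 / 2) ^ m := by
    intro m
    have h1 : ∀ᶠ t in 𝓝[>] (0 : ℝ), 0 < t := eventually_mem_nhdsWithin
    have h2 : ∀ᶠ t in 𝓝[>] (0 : ℝ), t < 1 / ((m : ℝ) + 1) :=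
      (gt_mem_nhds (by positivity)).filter_mono nhdsWithin_le_nhds
    have h3 : Tendsto (fun t => ‖f - S t f‖) (𝓝[>] 0) (𝓝 0) := by
      simpa using ((tendsto_const_nhds (x := f)).sub (hS.tendsto_zero f)).norm
    have h4 : ∀ᶠ t in 𝓝[>] (0 : ℝ), ‖f - S t f‖ < (1 / 2) ^ m :=
      h3.eventually_lt_const (by positivity)
    obtain ⟨t, ht⟩ := (h1.and (h2.and h4)).exists
    exact ⟨t, ht.1, ht.2.1, ht.2.2.le⟩
  choose τ hτ using h
  exact ⟨τ, fun m => (hτ m).1, squeeze_zero (fun m => (hτ m).1.le) (fun m => (hτ m).2.1.le)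
    tendsto_one_div_add_atTop_nhds_zero_nat, fun m => (hτ m).2.2⟩

/-- If a positive functional vanishes at one point of the orbit of `f ≥ 0` under a positive
holomorphic semigroup, then it vanishes on the whole orbit. -/
theorem apply_orbit_eq_zero (hS : IsC0Semigroup S) (hpos : IsPositiveSemigroup S)
    (hhol : IsHolomorphicSemigroup S) (hψ : ∀ u, 0 ≤ u → 0 ≤ ψ u) {f : Lp 𝕜 p μ} (hf : 0 ≤ f)
    {t₀ : ℝ} (ht₀ : 0 < t₀) (h0 : ψ (S t₀ f) = 0) {t : ℝ} (ht : 0 < t) : ψ (S t f) = 0 := by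
  obtain ⟨τ, hτ0, hτ, hτf⟩ := exists_seq_norm_apply_sub_le hS f
  let a : ℕ → Lp 𝕜 p μ := fun m => posRe (f - S (τ m) f)
  have ha : Summable a := Summable.of_norm_bounded
    (summable_geometric_of_lt_one (by norm_num) (by norm_num : (1 / 2 : ℝ) < 1))
    fun m => (norm_posRe_le _).trans (hτf m)
  let s : ℕ → Lp 𝕜 p μ := fun n => ∑' k, a (k + n)
  let g : ℕ → Lp 𝕜 p μ := fun n => posRe (f - s n)
  have hg : Tendsto g atTop (𝓝 f) := by
    have h1 : Tendsto (fun n => f - s n) atTop (𝓝 (f - 0)) :=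
      tendsto_const_nhds.sub (tendsto_sum_nat_add a)
    have h2 := (continuous_posRe.tendsto _).comp h1
    rwa [sub_zero, posRe_of_nonneg hf] at h2
  have hgle : ∀ n m, n ≤ m → g n ≤ S (τ m) f := by
    intro n m hnm
    refine posRe_sub_le hf (hpos _ (hτ0 m) _ hf) ?_
    -- `a m` is the term of index `m - n` in the tail `s n`, and a series of nonnegative terms
    -- dominates each term.
    have h1 := ((summable_nat_add_iff n).2 ha).le_tsum (m - n) fun j _ => posRe_nonneg _
    simpa only [Nat.sub_add_cancel hnm] using h1
  have hgzero : ∀ n, ψ (S t (g n)) = 0 := by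
    intro n
    have hana : AnalyticOnNhd ℝ (fun r => ψ (S r (g n))) (Set.Ioi 0) := fun r hr =>
      ((ψ.restrictScalars ℝ).analyticAt _).comp (hhol.analyticOnNhd_orbit (g n) r hr)
    refine hana.eqOn_zero_of_preconnected_of_frequently_eq_zero isPreconnected_Ioi ht₀ ?_ ht
    -- The zeros `t₀ - τ m` accumulate at `t₀` without meeting it because `τ m > 0`.
    have hlim : Tendsto (fun m => t₀ - τ m) atTop (𝓝[≠] t₀) := by
      refine tendsto_nhdsWithin_iff.2 ⟨by simpa using tendsto_const_nhds.sub hτ,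
        Eventually.of_forall fun m => ?_⟩
      have := hτ0 m
      simp only [Set.mem_compl_iff, Set.mem_singleton_iff]
      intro h
      linarith
    refine hlim.frequently (Eventually.frequently ?_)
    filter_upwards [eventually_ge_atTop n, hτ.eventually_lt_const ht₀] with m hm hm'
    have hr : 0 < t₀ - τ m := by linarith
    refine le_antisymm ?_ (hψ _ (hpos _ hr _ (posRe_nonneg _)))
    have h1 := hψ _ (hpos _ hr _ (sub_nonneg.2 (hgle n m hm)))
    have h2 := hS.isSemigroup (t₀ - τ m) (τ m) hr (hτ0 m)
    rw [sub_add_cancel] at h2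
    rw [h2] at h0
    rw [map_sub, map_sub, sub_nonneg] at h1
    exact h1.trans_eq h0
  have h1 : Tendsto (fun n => ψ (S t (g n))) atTop (𝓝 (ψ (S t f))) :=
    ((ψ.comp (S t)).continuous.tendsto f).comp hg
  simp only [hgzero] at h1
  exact tendsto_nhds_unique h1 tendsto_const_nhds

/-- The largest invariant ideal on whose orbits the positive functional `ψ` vanishes. -/
def orbitKernel (S : ℝ → Lp 𝕜 p μ →L[𝕜] Lp 𝕜 p μ) (ψ : Lp 𝕜 p μ →L[𝕜] 𝕜)
    (hpos : IsPositiveSemigroup S) (hψ : ∀ u, 0 ≤ u → 0 ≤ ψ u) : Submodule 𝕜 (Lp 𝕜 p μ) where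
  carrier := {u | ∀ t, 0 < t → ψ (S t (Modulus.modulus u)) = 0}
  zero_mem' := fun t _ => by
    rw [modulus_of_nonneg (le_refl (0 : Lp 𝕜 p μ)), map_zero, map_zero]
  add_mem' := by
    intro u v hu hv t ht
    refine le_antisymm ?_ (hψ _ (hpos t ht _ (modulus_nonneg _)))
    have h := hψ _ (hpos t ht _ (sub_nonneg.2 (modulus_add_le u v)))
    rwa [map_sub, map_sub, sub_nonneg, map_add, map_add, hu t ht, hv t ht, add_zero] at h
  smul_mem' := by
    intro c u hu t ht
    rw [modulus_smul, map_smul, map_smul, hu t ht, smul_zero]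

theorem mem_orbitKernel {hpos : IsPositiveSemigroup S} {hψ : ∀ u, 0 ≤ u → 0 ≤ ψ u}
    {u : Lp 𝕜 p μ} :
    u ∈ orbitKernel S ψ hpos hψ ↔ ∀ t, 0 < t → ψ (S t (Modulus.modulus u)) = 0 :=
  Iff.rfl

theorem isIdeal_orbitKernel (hpos : IsPositiveSemigroup S) (hψ : ∀ u, 0 ≤ u → 0 ≤ ψ u) :
    IsIdeal 𝕜 (orbitKernel S ψ hpos hψ) where
  modulus_mem u hu := by
    rw [mem_orbitKernel] at hu ⊢
    rwa [modulus_of_nonneg (modulus_nonneg u)]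
  mem_of_le u hu v hv huv := by
    rw [mem_orbitKernel] at hu ⊢
    rw [modulus_of_nonneg (hv.trans huv)] at hu
    rw [modulus_of_nonneg hv]
    intro t ht
    refine le_antisymm ?_ (hψ _ (hpos t ht _ hv))
    have h := hψ _ (hpos t ht _ (sub_nonneg.2 huv))
    rwa [map_sub, map_sub, sub_nonneg, hu t ht] at h

theorem isClosed_orbitKernel (hpos : IsPositiveSemigroup S) (hψ : ∀ u, 0 ≤ u → 0 ≤ ψ u) :
    IsClosed (orbitKernel S ψ hpos hψ : Set (Lp 𝕜 p μ)) := by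
  have h : (orbitKernel S ψ hpos hψ : Set (Lp 𝕜 p μ)) =
      ⋂ t : ℝ, ⋂ _ : 0 < t, {u | ψ (S t (Modulus.modulus u)) = 0} := by
    ext u
    simp [mem_orbitKernel]
  rw [h]
  exact isClosed_iInter fun t => isClosed_iInter fun _ =>
    isClosed_eq (ψ.continuous.comp ((S t).continuous.comp continuous_modulus)) continuous_const

theorem apply_mem_orbitKernel (hS : IsSemigroup S) (hpos : IsPositiveSemigroup S)
    (hψ : ∀ u, 0 ≤ u → 0 ≤ ψ u) {s : ℝ} (hs : 0 < s) {u : Lp 𝕜 p μ}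
    (hu : u ∈ orbitKernel S ψ hpos hψ) : S s u ∈ orbitKernel S ψ hpos hψ := by
  have hid := isIdeal_orbitKernel hpos hψ
  suffices h : u ∈ (orbitKernel S ψ hpos hψ).comap (S s : Lp 𝕜 p μ →ₗ[𝕜] Lp 𝕜 p μ) from h
  -- Reducing to nonnegative `v` avoids the need for `|S_s u| ≤ S_s |u|`.
  refine mem_of_forall_le_modulus fun v hv hvu => ?_
  have hv' := hid.mem_of_le _ (hid.modulus_mem _ hu) v hv hvu
  rw [mem_orbitKernel, modulus_of_nonneg hv] at hv'
  rw [Submodule.mem_comap, ContinuousLinearMap.coe_coe, mem_orbitKernel,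
    modulus_of_nonneg (hpos s hs v hv)]
  intro t ht
  have h := hv' (t + s) (by positivity)
  rwa [hS t s ht hs] at h

/-- Strict positivity of positive irreducible holomorphic semigroups, tested on a positive
functional. -/
theorem functional_eq_zero (hS : IsC0Semigroup S) (hpos : IsPositiveSemigroup S)
    (hirr : IsIrreducible S) (hhol : IsHolomorphicSemigroup S) (hψ : ∀ u, 0 ≤ u → 0 ≤ ψ u)
    {f : Lp 𝕜 p μ} (hf : 0 ≤ f) (hf0 : f ≠ 0) {t₀ : ℝ} (ht₀ : 0 < t₀) (h0 : ψ (S t₀ f) = 0)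
    (u : Lp 𝕜 p μ) : ψ u = 0 := by
  have hfJ : f ∈ orbitKernel S ψ hpos hψ := by
    rw [mem_orbitKernel, modulus_of_nonneg hf]
    exact fun t ht => apply_orbit_eq_zero hS hpos hhol hψ hf ht₀ h0 ht
  rcases hirr _ (isIdeal_orbitKernel hpos hψ) (isClosed_orbitKernel hpos hψ)
    (fun s hs u hu => apply_mem_orbitKernel hS.isSemigroup hpos hψ hs hu) with h | h
  · suffices h' : u ∈ LinearMap.ker (ψ : Lp 𝕜 p μ →ₗ[𝕜] 𝕜) from h'
    refine mem_of_forall_le_modulus fun v hv _ => ?_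
    have hvJ : v ∈ orbitKernel S ψ hpos hψ := h ▸ Submodule.mem_top
    rw [mem_orbitKernel, modulus_of_nonneg hv] at hvJ
    have h1 : Tendsto (fun t => ψ (S t v)) (𝓝[>] 0) (𝓝 (ψ v)) :=
      (ψ.continuous.tendsto v).comp (hS.tendsto_zero v)
    refine tendsto_nhds_unique h1 (tendsto_const_nhds.congr' ?_)
    filter_upwards [self_mem_nhdsWithin] with t ht using (hvJ t ht).symm
  · rw [h, Submodule.mem_bot] at hfJ
    exact absurd hfJ hf0

end Holomorphic

end LpSemigroup

namespace LpSemigroup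

/-! ### Strictly positive functions and ideals in `C(X)`, `X` compact. -/

section ContinuousMap

variable {𝕜 : Type*} [RCLike 𝕜] {X : Type*} [TopologicalSpace X] [CompactSpace X]

theorem exists_ofReal_le_of_pos {f : C(X, 𝕜)} (hf : ∀ x, 0 < f x) :
    ∃ c : ℝ, 0 < c ∧ ∀ x, (c : 𝕜) ≤ f x := by
  obtain ⟨c, hc, h⟩ := isCompact_univ.exists_forall_le' (f := fun x => RCLike.re (f x)) (a := 0)
    (by fun_prop) fun x _ => (RCLike.pos_iff.1 (hf x)).1
  refine ⟨c, hc, fun x => RCLike.le_iff_re_im.2 ⟨?_, ?_⟩⟩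
  · simpa using h x trivial
  · simp [(RCLike.pos_iff.1 (hf x)).2]

theorem exists_modulus_le_nsmul {f : C(X, 𝕜)} (hf : ∀ x, 0 < f x) (g : C(X, 𝕜)) :
    ∃ n : ℕ, Modulus.modulus g ≤ n • f := by
  obtain ⟨c, hc, h⟩ := exists_ofReal_le_of_pos hf
  obtain ⟨n, hn⟩ := exists_nat_ge (‖g‖ / c)
  refine ⟨n, fun x => ?_⟩
  rw [div_le_iff₀ hc] at hn
  have h1 : ((‖g x‖ : ℝ) : 𝕜) ≤ ((n * c : ℝ) : 𝕜) :=
    RCLike.ofReal_le_ofReal.2 ((g.norm_coe_le_norm x).trans hn)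
  refine h1.trans ?_
  change _ ≤ n • f x
  rw [nsmul_eq_mul, RCLike.ofReal_mul, RCLike.ofReal_natCast]
  exact mul_le_mul_of_nonneg_left (h x) (Nat.cast_nonneg n)

theorem isQuasiInterior_of_pos {f : C(X, 𝕜)} (hf : ∀ x, 0 < f x) : IsQuasiInterior f := by
  refine ⟨fun x => (hf x).le, ?_⟩
  rw [show principalIdeal f = Set.univ from
    Set.eq_univ_of_forall fun g => exists_modulus_le_nsmul hf g, closure_univ]

theorem IsIdeal.eq_top_of_pos_mem {J : Submodule 𝕜 C(X, 𝕜)} (hJ : IsIdeal 𝕜 J) {f : C(X, 𝕜)}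
    (hfJ : f ∈ J) (hf : ∀ x, 0 < f x) : J = ⊤ := by
  have hnonneg : ∀ g : C(X, 𝕜), 0 ≤ g → g ∈ J := by
    intro g hg
    obtain ⟨n, hn⟩ := exists_modulus_le_nsmul hf g
    have hmod : Modulus.modulus g = g := by
      ext x
      exact RCLike.norm_of_nonneg' (hg x)
    exact hJ.mem_of_le _ (J.nsmul_mem hfJ n) g hg (hmod ▸ hn)
  -- A real function is the difference of the nonnegative functions `r + ‖r‖` and `‖r‖`.
  have hreal : ∀ r : C(X, ℝ), (⟨fun x => (r x : 𝕜), by fun_prop⟩ : C(X, 𝕜)) ∈ J := by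
    intro r
    have h1 : (⟨fun x => ((r x + ‖r‖ : ℝ) : 𝕜), by fun_prop⟩ : C(X, 𝕜)) ∈ J := by
      refine hnonneg _ fun x => RCLike.ofReal_nonneg.2 ?_
      linarith [(abs_le.1 (r.norm_coe_le_norm x)).1]
    have h2 : (⟨fun _ => ((‖r‖ : ℝ) : 𝕜), by fun_prop⟩ : C(X, 𝕜)) ∈ J :=
      hnonneg _ fun x => RCLike.ofReal_nonneg.2 (norm_nonneg _)
    convert J.sub_mem h1 h2 using 1
    ext x
    simp
  refine eq_top_iff.2 fun g _ => ?_
  convert J.add_mem (hreal ⟨fun x => RCLike.re (g x), by fun_prop⟩)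
    (J.smul_mem (RCLike.I : 𝕜) (hreal ⟨fun x => RCLike.im (g x), by fun_prop⟩)) using 1
  ext x
  simp only [ContinuousMap.add_apply, ContinuousMap.smul_apply, ContinuousMap.coe_mk, smul_eq_mul]
  rw [mul_comm, RCLike.re_add_im]

end ContinuousMap

/-! ### The embedding of `C(closure Ω)` into `L_p(Ω)`. -/

section Embedding

variable {𝕜 : Type*} [RCLike 𝕜] {d : ℕ} {Ω : Set (EuclideanSpace ℝ (Fin d))} {p : ℝ≥0∞}

/-- The set where `f ≤ g` is closed. It is dense because every neighbourhood of a point of the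
closure meets `Ω` in a set of positive measure; this is what reaches the boundary. -/
theorem continuousMap_le_of_ae_le (hΩ : IsOpen Ω) {f g : C(closure Ω, 𝕜)}
    (h : ∀ᵐ x ∂(volume.restrict Ω), ∀ hx : x ∈ closure Ω, f ⟨x, hx⟩ ≤ g ⟨x, hx⟩) : f ≤ g := by
  have hcl : IsClosed {x : closure Ω | f x ≤ g x} := isClosed_le f.continuous g.continuous
  suffices hsub : Dense {x : closure Ω | f x ≤ g x} by
    intro x
    have := hcl.closure_eq ▸ hsub x
    exact this
  intro x
  rw [mem_closure_iff]
  intro U hU hxU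
  obtain ⟨V, hV, rfl⟩ := isOpen_induced_iff.1 hU
  obtain ⟨y, hyV, hyΩ⟩ := mem_closure_iff.1 x.2 V hV hxU
  have hpos : 0 < volume (V ∩ Ω) := (hV.inter hΩ).measure_pos volume ⟨y, hyV, hyΩ⟩
  rw [ae_restrict_iff' hΩ.measurableSet] at h
  obtain ⟨z, hz, hz'⟩ := (frequently_ae_mem_iff.2 hpos.ne').and_eventually h |>.exists
  exact ⟨⟨z, subset_closure hz.2⟩, hz.1, hz' hz.2 _⟩

theorem ae_mem_closure (hΩ : IsOpen Ω) : ∀ᵐ x ∂(volume.restrict Ω), x ∈ closure Ω := by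
  filter_upwards [ae_restrict_mem hΩ.measurableSet] with x hx using subset_closure hx

variable [CompactSpace (closure Ω)] [IsFiniteMeasure (volume.restrict Ω)]

theorem memLp_extend (f : C(closure Ω, 𝕜)) :
    MemLp (Function.extend Subtype.val f 0) p (volume.restrict Ω) := by
  refine MemLp.of_bound ?_ ‖f‖ (Eventually.of_forall fun x => ?_)
  · exact ((MeasurableEmbedding.subtype_coe isClosed_closure.measurableSet).measurable_extend
      f.continuous.measurable measurable_zero).aestronglyMeasurable
  · by_cases hx : x ∈ closure Ω
    · rw [show x = ((⟨x, hx⟩ : closure Ω) : EuclideanSpace ℝ (Fin d)) from rfl,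
        Subtype.val_injective.extend_apply]
      exact f.norm_coe_le_norm _
    · rw [Function.extend_apply' _ _ _ (by rintro ⟨y, rfl⟩; exact hx y.2)]
      simp

theorem coeFn_toLp_extend (f : C(closure Ω, 𝕜)) : ∀ᵐ x ∂(volume.restrict Ω),
    ∀ hx : x ∈ closure Ω, ((memLp_extend f).toLp _ : Lp 𝕜 p (volume.restrict Ω)) x = f ⟨x, hx⟩ := by
  filter_upwards [(memLp_extend (p := p) f).coeFn_toLp] with x h hx
  rw [h]
  exact Subtype.val_injective.extend_apply f 0 ⟨x, hx⟩

theorem isContinuousVersion_iff (hΩ : IsOpen Ω) {f : C(closure Ω, 𝕜)}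
    {u : Lp 𝕜 p (volume.restrict Ω)} :
    IsContinuousVersion f u ↔ (memLp_extend f).toLp _ = u := by
  constructor
  · intro h
    apply Lp.ext
    filter_upwards [h, coeFn_toLp_extend (p := p) f, ae_mem_closure hΩ] with x h1 h2 h3
    rw [h2 h3, h1 h3]
  · rintro rfl
    filter_upwards [coeFn_toLp_extend (p := p) f] with x h1 hx
    rw [h1 hx]

variable [Fact (1 ≤ p)]

/-- The embedding of `C(closure Ω)` into `L_p(Ω)`. -/
noncomputable def continuousMapToLp (𝕜 : Type*) [RCLike 𝕜] (p : ℝ≥0∞) [Fact (1 ≤ p)] (hΩ : IsOpen Ω) :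
    C(closure Ω, 𝕜) →L[𝕜] Lp 𝕜 p (volume.restrict Ω) :=
  LinearMap.mkContinuous
    { toFun := fun f => (memLp_extend f).toLp _
      map_add' := fun f g => by
        apply Lp.ext
        filter_upwards [coeFn_toLp_extend (p := p) (f + g), coeFn_toLp_extend (p := p) f,
          coeFn_toLp_extend (p := p) g, ae_mem_closure hΩ,
          Lp.coeFn_add ((memLp_extend (p := p) f).toLp _) ((memLp_extend (p := p) g).toLp _)]
          with x h1 h2 h3 h4 h5
        rw [h5, Pi.add_apply, h1 h4, h2 h4, h3 h4, ContinuousMap.add_apply]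
      map_smul' := fun c f => by
        apply Lp.ext
        filter_upwards [coeFn_toLp_extend (p := p) (c • f), coeFn_toLp_extend (p := p) f,
          ae_mem_closure hΩ, Lp.coeFn_smul c ((memLp_extend (p := p) f).toLp _)]
          with x h1 h2 h4 h5
        rw [RingHom.id_apply, h5, Pi.smul_apply, h1 h4, h2 h4, ContinuousMap.smul_apply] }
    ((measureUnivNNReal (volume.restrict Ω) : ℝ) ^ p.toReal⁻¹)
    fun f => by
      refine Lp.norm_le_of_ae_bound (norm_nonneg f) ?_
      filter_upwards [coeFn_toLp_extend (p := p) f, ae_mem_closure hΩ] with x h1 h2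
      exact (congrArg norm (h1 h2)).trans_le (f.norm_coe_le_norm _)

theorem isContinuousVersion_iff_continuousMapToLp (hΩ : IsOpen Ω) {f : C(closure Ω, 𝕜)}
    {u : Lp 𝕜 p (volume.restrict Ω)} :
    IsContinuousVersion f u ↔ continuousMapToLp 𝕜 p hΩ f = u :=
  isContinuousVersion_iff hΩ

theorem continuousMapToLp_nonneg_iff (hΩ : IsOpen Ω) {f : C(closure Ω, 𝕜)} :
    0 ≤ continuousMapToLp 𝕜 p hΩ f ↔ 0 ≤ f := by
  rw [nonneg_iff_ae]
  have hae := (isContinuousVersion_iff_continuousMapToLp (p := p) hΩ (f := f)).2 rfl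
  constructor
  · intro h
    refine continuousMap_le_of_ae_le hΩ ?_
    filter_upwards [h, hae] with x h1 h2 hx
    rw [h2 hx]
    exact h1
  · intro h
    filter_upwards [hae, ae_mem_closure hΩ] with x h2 hx
    rw [← h2 hx]
    exact h _

theorem continuousMapToLp_injective (hΩ : IsOpen Ω) :
    Function.Injective (continuousMapToLp 𝕜 p hΩ) := by
  refine (injective_iff_map_eq_zero _).2 fun f hf => le_antisymm ?_ ?_
  · rw [← neg_nonneg, ← continuousMapToLp_nonneg_iff (p := p) hΩ, map_neg, hf, neg_zero]
  · rw [← continuousMapToLp_nonneg_iff (p := p) hΩ, hf]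

/-- By the closed graph theorem, an operator on `L_p(Ω)` with values in `C(closure Ω)` is bounded
as an operator into `C(closure Ω)`. -/
theorem exists_comp_continuousMapToLp_eq (hΩ : IsOpen Ω)
    (A : Lp 𝕜 p (volume.restrict Ω) →L[𝕜] Lp 𝕜 p (volume.restrict Ω))
    (hA : ∀ u, ∃ g : C(closure Ω, 𝕜), continuousMapToLp 𝕜 p hΩ g = A u) :
    ∃ R : Lp 𝕜 p (volume.restrict Ω) →L[𝕜] C(closure Ω, 𝕜),
      ∀ u, continuousMapToLp 𝕜 p hΩ (R u) = A u := by
  have hinj := continuousMapToLp_injective (𝕜 := 𝕜) (p := p) hΩ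
  choose r hr using hA
  let g : Lp 𝕜 p (volume.restrict Ω) →ₗ[𝕜] C(closure Ω, 𝕜) :=
    { toFun := r
      map_add' := fun u v => hinj (by simp only [map_add, hr])
      map_smul' := fun c u => hinj (by simp only [map_smul, hr, RingHom.id_apply]) }
  have hg : ∀ (u : ℕ → Lp 𝕜 p (volume.restrict Ω)) x y, Tendsto u atTop (𝓝 x) →
      Tendsto (g ∘ u) atTop (𝓝 y) → y = g x := by
    intro u x y hu hgu
    have h1 := ((continuousMapToLp 𝕜 p hΩ).continuous.tendsto y).comp hgu
    have h2 := (A.continuous.tendsto x).comp hu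
    -- Uniform convergence implies `L_p` convergence, where both limits must agree.
    refine hinj ((tendsto_nhds_unique h1 ?_).trans (hr x).symm)
    exact h2.congr fun n => (hr (u n)).symm
  exact ⟨ContinuousLinearMap.ofSeqClosedGraph hg, hr⟩

/-- The restriction of a positive irreducible holomorphic semigroup on `L_p(Ω)` is strictly
positive at each point of `closure Ω` at which not all functions `S_t w` vanish. -/
theorem regularized_pos (hΩ : IsOpen Ω)
    {S : ℝ → Lp 𝕜 p (volume.restrict Ω) →L[𝕜] Lp 𝕜 p (volume.restrict Ω)}
    (hS : IsC0Semigroup S) (hpos : IsPositiveSemigroup S) (hirr : IsIrreducible S)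
    (hhol : IsHolomorphicSemigroup S)
    {R : ℝ → Lp 𝕜 p (volume.restrict Ω) →L[𝕜] C(closure Ω, 𝕜)}
    (hR : ∀ t, 0 < t → ∀ u, continuousMapToLp 𝕜 p hΩ (R t u) = S t u)
    {x : closure Ω} (hx : ∃ t, 0 < t ∧ ∃ w, R t w x ≠ 0) {t : ℝ} (ht : 0 < t)
    {u : Lp 𝕜 p (volume.restrict Ω)} (hu : 0 ≤ u) (hu0 : u ≠ 0) : 0 < R t u x := by
  have hRpos : ∀ s, 0 < s → ∀ v, 0 ≤ v → 0 ≤ R s v := fun s hs v hv => by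
    rw [← continuousMapToLp_nonneg_iff (p := p) hΩ, hR s hs]
    exact hpos s hs v hv
  have hRS : ∀ r s, 0 < r → 0 < s → ∀ v, R (r + s) v = R r (S s v) := fun r s hr hs v => by
    apply continuousMapToLp_injective (p := p) hΩ
    rw [hR _ (add_pos hr hs), hR r hr, hS.isSemigroup r s hr hs]
    rfl
  refine lt_of_le_of_ne (hRpos t ht u hu x) fun h0 => ?_
  obtain ⟨t', ht', w, hw⟩ := hx
  -- With `ε` below both times, one functional `ψ` expresses both values at `x`: `R t u x = ψ (S (t
  -- - ε) u)` and `R t' w x = ψ (S (t' - ε) w)`.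
  obtain ⟨ε, hε, hεm⟩ := exists_between (lt_min ht ht')
  obtain ⟨hεt, hεt'⟩ := lt_min_iff.1 hεm
  let ψ : Lp 𝕜 p (volume.restrict Ω) →L[𝕜] 𝕜 := (ContinuousMap.evalCLM 𝕜 x).comp (R ε)
  have hψ : ∀ v, 0 ≤ v → 0 ≤ ψ v := fun v hv => hRpos ε hε v hv x
  have h1 : ψ (S (t - ε) u) = 0 := by
    change R ε (S (t - ε) u) x = 0
    rw [← hRS ε (t - ε) hε (sub_pos.2 hεt), add_sub_cancel, ← h0]
  apply hw
  rw [← add_sub_cancel ε t', hRS ε (t' - ε) hε (sub_pos.2 hεt')]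
  exact functional_eq_zero hS hpos hirr hhol hψ hu hu0 (sub_pos.2 hεt) h1 _

end Embedding

end LpSemigroup

/-! ### Positivity improvement and irreducibility on `C(closure Ω)`. -/

theorem corollary3p2 {𝕜 : Type*} [RCLike 𝕜] {d : ℕ} (Ω : Set (EuclideanSpace ℝ (Fin d)))
    (hΩ : IsOpen Ω) (hΩb : Bornology.IsBounded Ω)
    (p : ℝ≥0∞) [Fact (1 ≤ p)] (hp : p ≠ ∞)
    (S : ℝ → Lp 𝕜 p (volume.restrict Ω) →L[𝕜] Lp 𝕜 p (volume.restrict Ω))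
    (hS : LpSemigroup.IsC0Semigroup S)
    (hpos : LpSemigroup.IsPositiveSemigroup S)
    (hirr : LpSemigroup.IsIrreducible S)
    (hhol : LpSemigroup.IsHolomorphicSemigroup S)
    (hcont : ∀ t : ℝ, 0 < t → ∀ u : Lp 𝕜 p (volume.restrict Ω),
      ∃ g : C(closure Ω, 𝕜), LpSemigroup.IsContinuousVersion g (S t u))
    (hne : ∀ x : closure Ω, ∃ t : ℝ, 0 < t ∧ ∃ w : Lp 𝕜 p (volume.restrict Ω),
      ∃ g : C(closure Ω, 𝕜), LpSemigroup.IsContinuousVersion g (S t w) ∧ g x ≠ 0) :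
    (∀ t : ℝ, 0 < t → ∃ R : Lp 𝕜 p (volume.restrict Ω) →L[𝕜] C(closure Ω, 𝕜),
      (∀ u, LpSemigroup.IsContinuousVersion (R u) (S t u)) ∧
      LpSemigroup.IsPositivityImproving R ∧
      ∀ u : Lp 𝕜 p (volume.restrict Ω), 0 ≤ u → u ≠ 0 → ∀ x : closure Ω, 0 < R u x) ∧
    ∃ T : ℝ → C(closure Ω, 𝕜) →L[𝕜] C(closure Ω, 𝕜),
      (∀ t : ℝ, 0 < t → ∀ f : C(closure Ω, 𝕜), ∃ u : Lp 𝕜 p (volume.restrict Ω),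
        LpSemigroup.IsContinuousVersion f u ∧
        LpSemigroup.IsContinuousVersion (T t f) (S t u)) ∧
      LpSemigroup.IsSemigroup T ∧
      LpSemigroup.IsIrreducible T := by
  have : CompactSpace (closure Ω) := isCompact_iff_compactSpace.1 hΩb.isCompact_closure
  have : IsFiniteMeasure (volume.restrict Ω) :=
    ⟨by rw [Measure.restrict_apply_univ]; exact hΩb.measure_lt_top⟩
  let j := LpSemigroup.continuousMapToLp 𝕜 p hΩ
  have hj : Function.Injective j := LpSemigroup.continuousMapToLp_injective hΩ
  have hR : ∀ t : ℝ, ∃ R : Lp 𝕜 p (volume.restrict Ω) →L[𝕜] C(closure Ω, 𝕜),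
      0 < t → ∀ u, j (R u) = S t u := by
    intro t
    by_cases ht : 0 < t
    · obtain ⟨R, hR⟩ := LpSemigroup.exists_comp_continuousMapToLp_eq hΩ (S t) fun u =>
        (hcont t ht u).imp fun g hg =>
          (LpSemigroup.isContinuousVersion_iff_continuousMapToLp hΩ).1 hg
      exact ⟨R, fun _ => hR⟩
    · exact ⟨0, fun h => absurd h ht⟩
  choose R hR using hR
  have hRpos : ∀ t : ℝ, 0 < t → ∀ u : Lp 𝕜 p (volume.restrict Ω), 0 ≤ u → u ≠ 0 →
      ∀ x : closure Ω, 0 < R t u x := by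
    intro t ht u hu hu0 x
    refine LpSemigroup.regularized_pos hΩ hS hpos hirr hhol hR ?_ ht hu hu0
    obtain ⟨s, hs, w, g, hg, hgx⟩ := hne x
    refine ⟨s, hs, w, ?_⟩
    -- Continuous versions are unique, so the `g` supplied by (II) is `R s w`.
    rwa [hj ((hR s hs w).trans
      ((LpSemigroup.isContinuousVersion_iff_continuousMapToLp hΩ).1 hg).symm)]
  refine ⟨fun t ht => ⟨R t, fun u =>
    (LpSemigroup.isContinuousVersion_iff_continuousMapToLp hΩ).2 (hR t ht u),
    fun u hu hu0 => LpSemigroup.isQuasiInterior_of_pos (hRpos t ht u hu hu0), hRpos t ht⟩,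
    fun t => (R t).comp j, fun t ht f => ⟨j f,
    (LpSemigroup.isContinuousVersion_iff_continuousMapToLp hΩ).2 rfl,
    (LpSemigroup.isContinuousVersion_iff_continuousMapToLp hΩ).2 (hR t ht (j f))⟩, ?_, ?_⟩
  · intro s t hs ht
    refine ContinuousLinearMap.ext fun f => hj ?_
    simp only [ContinuousLinearMap.comp_apply]
    rw [hR _ (add_pos hs ht), hR s hs, hR t ht, hS.isSemigroup s t hs ht]
    rfl
  · intro J hJ _ hinv
    refine or_iff_not_imp_right.2 fun hJ0 => ?_
    obtain ⟨f, hfJ, hf0⟩ := J.exists_mem_ne_zero_of_ne_bot hJ0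
    have hmod : (0 : C(closure Ω, 𝕜)) ≤ LpSemigroup.Modulus.modulus f := fun x =>
      RCLike.ofReal_nonneg.2 (norm_nonneg (f x))
    have hmod0 : (LpSemigroup.Modulus.modulus f : C(closure Ω, 𝕜)) ≠ 0 := by
      intro h
      refine hf0 (ContinuousMap.ext fun x => ?_)
      have hx : ((‖f x‖ : ℝ) : 𝕜) = 0 := DFunLike.congr_fun h x
      simpa using hx
    -- Any positive time would serve in place of `1`.
    exact hJ.eq_top_of_pos_mem (hinv 1 one_pos _ (hJ.modulus_mem f hfJ))
      (hRpos 1 one_pos _ ((LpSemigroup.continuousMapToLp_nonneg_iff hΩ).2 hmod)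
        ((map_ne_zero_iff j hj).2 hmod0))
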